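/- There are a fixed program for the word RAM (unit-cost arithmetic, bitwise, shift, comparison, jump and load instructions on $w$-bit words, a constant number of registers, read-only access to the data structure), constants $\kappa$ and $C$, and a function $f(n)\in o(n)$ such that the following holds. For every probability distribution $P=p_1,\dots,p_n$ (a sequence of non-negative numbers with sum $1$) there is a probability distribution $Q=q_1,\dots,q_n$, with all $q_i>0$, such that \[\max_{1\le i\le n}\frac{p_i}{q_i}<4,\qquad\text{so}\qquad D(P\|Q)=\sum_{i=1}^n p_i\log_2\frac{p_i}{q_i}<2,\] and for every word length $w\ge \lfloor\log_2 n\rfloor+1+\kappa$ there is a data structure (a bit string) of at most $2n+f(n)$ bits on which the program, given $i$ between $1$ and $n$ (and the parameters $n$ and $w$), returns $q_i$ exactly, as a number $a/(b\,2^e)$ given by three words $a,b,e$, in $O(\log(1/q_i))$ time: the number of steps is at most $C\log_2(1/q_i)$ if $n\ge 2$, and at most $C$ if $n=1$ (where $q_1=1$). Since $\log_2(1/q_i)<\log_2(1/p_i)+2$, the query time is also $O(\log(1/p_i))$: it is at most $C\,(1+\log_2(1/p_i))$ whenever $p_i>0$. -/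

import Mathlib

/-- The relative entropy `D(P‖Q) = ∑ᵢ pᵢ log₂ (pᵢ / qᵢ)` of two finite distributions, for a `Q`
whose probabilities are all positive (terms with `pᵢ = 0` contribute `0`). -/
noncomputable def relEntropy {n : ℕ} (p q : Fin n → ℝ) : ℝ :=
  ∑ i, p i * Real.logb 2 (p i / q i)

/-! A word RAM with `w`-bit words. A query program has a fixed finite number of registers, each
holding one word (a natural number below `2 ^ w`), and read-only access, word by word, to the
bit string that is the data structure. Every instruction takes one step. -/

namespace WordRAM

/-- The binary word operations. -/
inductive BinOp where
  | add | sub | mul | div | mod | and | or | xor | shl | shr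

/-- The result of a word operation, modulo `2 ^ w` (subtraction wraps around). -/
def BinOp.eval (w : ℕ) : BinOp → ℕ → ℕ → ℕ
  | .add, x, y => (x + y) % 2 ^ w
  | .sub, x, y => (x + (2 ^ w - y)) % 2 ^ w
  | .mul, x, y => (x * y) % 2 ^ w
  | .div, x, y => (x / y) % 2 ^ w
  | .mod, x, y => (x % y) % 2 ^ w
  | .and, x, y => (x &&& y) % 2 ^ w
  | .or, x, y => (x ||| y) % 2 ^ w
  | .xor, x, y => (x ^^^ y) % 2 ^ w
  | .shl, x, y => (x <<< y) % 2 ^ w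
  | .shr, x, y => (x >>> y) % 2 ^ w

/-- Instructions; `d`, `a`, `b` are register names and `l` is a position in the program. -/
inductive Instr where
  /-- `R[d] := c` -/
  | const (d c : ℕ)
  /-- `R[d] := R[a] o R[b]` -/
  | op (o : BinOp) (d a b : ℕ)
  /-- `R[d] := M[R[a]]`, where `M` is the data memory -/
  | load (d a : ℕ)
  /-- `goto l` -/
  | jmp (l : ℕ)
  /-- `if R[a] < R[b] then goto l` -/
  | jlt (a b l : ℕ)
  /-- `if R[a] = R[b] then goto l` -/
  | jeq (a b l : ℕ)

/-- A program is a finite list of instructions (so it uses finitely many registers). -/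
abbrev Program := List Instr

/-- A configuration: the program counter and the contents of the registers. -/
structure State where
  pc : ℕ
  reg : ℕ → ℕ

/-- The effect of one instruction. -/
def Instr.exec (w : ℕ) (mem : ℕ → ℕ) (s : State) : Instr → State
  | .const d c => ⟨s.pc + 1, Function.update s.reg d (c % 2 ^ w)⟩
  | .op o d a b => ⟨s.pc + 1, Function.update s.reg d (o.eval w (s.reg a) (s.reg b))⟩
  | .load d a => ⟨s.pc + 1, Function.update s.reg d (mem (s.reg a))⟩
  | .jmp l => ⟨l, s.reg⟩
  | .jlt a b l => ⟨if s.reg a < s.reg b then l else s.pc + 1, s.reg⟩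
  | .jeq a b l => ⟨if s.reg a = s.reg b then l else s.pc + 1, s.reg⟩

/-- The machine has halted when the program counter is beyond the end of the program. -/
def Halted (prog : Program) (s : State) : Prop := prog.length ≤ s.pc

/-- One step; a halted machine stays as it is. -/
def step (w : ℕ) (mem : ℕ → ℕ) (prog : Program) (s : State) : State :=
  match prog[s.pc]? with
  | none => s
  | some ins => ins.exec w mem s

/-- The configuration after `t` steps. -/
def run (w : ℕ) (mem : ℕ → ℕ) (prog : Program) (t : ℕ) (s : State) : State :=
  (step w mem prog)^[t] s

/-- The data memory holding the bit string `D`: word `k` consists of the bits at positions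
`k * w, …, k * w + w - 1` of `D`, least significant first; beyond the end of `D` all bits are `0`. -/
def memory (w : ℕ) (D : List Bool) (k : ℕ) : ℕ :=
  ∑ j ∈ Finset.range w, if D.getD (k * w + j) false then 2 ^ j else 0

/-- The start of a query: `R[0]` holds the index `i`, counted from `0`, `R[1]` the number `n` of
probabilities, `R[2]` the word length `w`, and all other registers hold `0`. -/
def queryState (w n i : ℕ) : State where
  pc := 0
  reg := fun r => if r = 0 then i else if r = 1 then n else if r = 2 then w else 0

/-- The number that the machine returns, exactly, as three words: `R[0] / (R[1] * 2 ^ R[2])`. -/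
noncomputable def output (s : State) : ℝ :=
  (s.reg 0 : ℝ) / ((s.reg 1 : ℝ) * 2 ^ s.reg 2)

/-- On a machine with `w`-bit words, `prog`, run on the data structure `D` and given `n` and `i`,
halts within `t` steps and returns `x`. -/
def AnswersWithin (prog : Program) (w : ℕ) (D : List Bool) (n i t : ℕ) (x : ℝ) : Prop :=
  Halted prog (run w (memory w D) prog t (queryState w n i)) ∧
    output (run w (memory w D) prog t (queryState w n i)) = x

end WordRAM

/-! Let `N = n + ⌊n/2⌋` and cut `N` positions into `n` intervals: each gets one position, and
`⌊n/2⌋` further ones are shared out by flooring `n/2` times the prefix sums of `p` (`startPoint`).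
Interval `i` is then longer than `(n/2) pᵢ`, and `N ≤ 3n/2`, so `qᵢ = length / N` exceeds `pᵢ / 3`.
Bounding every ratio `pᵢ / qᵢ` bounds the entropy.

It remains to store the partition. One bit per position marks the starts of intervals. For every
chunk of `8 * n.size` positions a table holds the index and the length of the interval covering the
chunk's start, at `2 * n.size` bits per entry. The table costs about `N/4`, so the total is about
`5N/4 ≤ 15n/8` plus `O(log n)`.

A query searches the sorted table for `i` by bisection. If `c > 0` chunks start inside interval `i`,
they all stay in the search range until one of them is probed, so about `log (chunks n / c) = log
(1/qᵢ) + O(1)` rounds suffice (`within_query_of_hit`). If none does, the interval has `O(log n)`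
positions, so `log (1/qᵢ)` is of order `log n`, which pays for a full search and a bit-by-bit scan
of one chunk (`within_query_of_miss`). `exists_within_query` combines the two cases, and
`exists_encodes` supplies the data structure. -/

namespace WordRAM

/-! ### Reasoning about executions -/

/-- Some configuration reached from `s` within `t` steps satisfies `Q`. -/
def Within (w : ℕ) (mem : ℕ → ℕ) (prog : Program) (t : ℕ) (s : State) (Q : State → Prop) : Prop :=
  ∃ k ≤ t, Q (run w mem prog k s)

section Within

variable {w t u pc : ℕ} {mem : ℕ → ℕ} {prog : Program} {s : State} {r : ℕ → ℕ}
  {P Q : State → Prop}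

theorem Within.here (h : Q s) : Within w mem prog t s Q := ⟨0, Nat.zero_le _, h⟩

theorem Within.bind (h : Within w mem prog t s P)
    (H : ∀ s', P s' → Within w mem prog u s' Q) : Within w mem prog (t + u) s Q := by
  obtain ⟨k, hk, hP⟩ := h
  obtain ⟨l, hl, hQ⟩ := H _ hP
  refine ⟨l + k, by omega, ?_⟩
  rw [run, Function.iterate_add_apply]
  exact hQ

theorem Within.mono (h : Within w mem prog t s Q) (htu : t ≤ u) : Within w mem prog u s Q :=
  let ⟨k, hk, hQ⟩ := h
  ⟨k, hk.trans htu, hQ⟩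

theorem Within.of_step (h : Within w mem prog t (step w mem prog s) Q) :
    Within w mem prog (t + 1) s Q :=
  let ⟨k, hk, hQ⟩ := h
  ⟨k + 1, Nat.succ_le_succ hk, hQ⟩

theorem Within.const {d c : ℕ} (h : prog[pc]? = some (.const d c)) (hc : c < 2 ^ w)
    (H : Within w mem prog t ⟨pc + 1, Function.update r d c⟩ Q) :
    Within w mem prog (t + 1) ⟨pc, r⟩ Q := by
  apply Within.of_step
  simpa [step, h, Instr.exec, Nat.mod_eq_of_lt hc] using H

theorem Within.op {o : BinOp} {d a b : ℕ} (v : ℕ) (h : prog[pc]? = some (.op o d a b))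
    (hv : o.eval w (r a) (r b) = v)
    (H : Within w mem prog t ⟨pc + 1, Function.update r d v⟩ Q) :
    Within w mem prog (t + 1) ⟨pc, r⟩ Q := by
  apply Within.of_step
  simpa [step, h, Instr.exec, hv] using H

theorem Within.load {d a : ℕ} (v : ℕ) (h : prog[pc]? = some (.load d a)) (hv : mem (r a) = v)
    (H : Within w mem prog t ⟨pc + 1, Function.update r d v⟩ Q) :
    Within w mem prog (t + 1) ⟨pc, r⟩ Q := by
  apply Within.of_step
  simpa [step, h, Instr.exec, hv] using H

theorem Within.jmp {l : ℕ} (h : prog[pc]? = some (.jmp l))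
    (H : Within w mem prog t ⟨l, r⟩ Q) : Within w mem prog (t + 1) ⟨pc, r⟩ Q := by
  apply Within.of_step
  simpa [step, h, Instr.exec] using H

theorem Within.jlt_pos {a b l : ℕ} (h : prog[pc]? = some (.jlt a b l)) (hab : r a < r b)
    (H : Within w mem prog t ⟨l, r⟩ Q) : Within w mem prog (t + 1) ⟨pc, r⟩ Q := by
  apply Within.of_step
  simpa [step, h, Instr.exec, hab] using H

theorem Within.jlt_neg {a b l : ℕ} (h : prog[pc]? = some (.jlt a b l)) (hab : ¬ r a < r b)
    (H : Within w mem prog t ⟨pc + 1, r⟩ Q) : Within w mem prog (t + 1) ⟨pc, r⟩ Q := by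
  apply Within.of_step
  simpa only [step, h, Instr.exec, hab, if_false] using H

theorem Within.jeq_pos {a b l : ℕ} (h : prog[pc]? = some (.jeq a b l)) (hab : r a = r b)
    (H : Within w mem prog t ⟨l, r⟩ Q) : Within w mem prog (t + 1) ⟨pc, r⟩ Q := by
  apply Within.of_step
  simpa [step, h, Instr.exec, hab] using H

theorem Within.jeq_neg {a b l : ℕ} (h : prog[pc]? = some (.jeq a b l)) (hab : r a ≠ r b)
    (H : Within w mem prog t ⟨pc + 1, r⟩ Q) : Within w mem prog (t + 1) ⟨pc, r⟩ Q := by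
  apply Within.of_step
  simpa [step, h, Instr.exec, hab] using H

end Within

/-! ### Word operations whose result does not overflow. -/

section Eval

variable {w x y : ℕ}

theorem eval_add (h : x + y < 2 ^ w) : BinOp.add.eval w x y = x + y := Nat.mod_eq_of_lt h

theorem eval_mul (h : x * y < 2 ^ w) : BinOp.mul.eval w x y = x * y := Nat.mod_eq_of_lt h

theorem eval_sub (hyx : y ≤ x) (hx : x < 2 ^ w) : BinOp.sub.eval w x y = x - y := by
  have : x + (2 ^ w - y) = x - y + 2 ^ w := by omega
  rw [BinOp.eval, this, Nat.add_mod_right, Nat.mod_eq_of_lt (by omega)]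

theorem eval_div (hx : x < 2 ^ w) : BinOp.div.eval w x y = x / y :=
  Nat.mod_eq_of_lt ((Nat.div_le_self x y).trans_lt hx)

theorem eval_mod (hx : x < 2 ^ w) : BinOp.mod.eval w x y = x % y :=
  Nat.mod_eq_of_lt ((Nat.mod_le x y).trans_lt hx)

theorem eval_shr (hx : x < 2 ^ w) : BinOp.shr.eval w x y = x >>> y :=
  Nat.mod_eq_of_lt ((Nat.shiftRight_le x y).trans_lt hx)

end Eval

/-! ### Bits of the memory -/

theorem sum_bits_lt (b : ℕ → Bool) (w : ℕ) :
    (∑ j ∈ Finset.range w, if b j then 2 ^ j else 0) < 2 ^ w := by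
  induction w with
  | zero => simp
  | succ w ih => rw [Finset.sum_range_succ, pow_succ]; split_ifs <;> omega

theorem testBit_sum_bits (b : ℕ → Bool) (w j : ℕ) :
    (∑ j ∈ Finset.range w, if b j then 2 ^ j else 0).testBit j = (decide (j < w) && b j) := by
  induction w with
  | zero => simp
  | succ w ih =>
    have hlt := sum_bits_lt b w
    rw [Finset.sum_range_succ]
    rcases lt_trichotomy j w with h | rfl | h
    · by_cases hb : b w
      · rw [if_pos hb, add_comm, Nat.testBit_two_pow_add_gt h, ih]
        simp [h, h.trans (Nat.lt_succ_self w)]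
      · rw [if_neg hb, add_zero, ih]
        simp [h, h.trans (Nat.lt_succ_self w)]
    · by_cases hb : b j
      · rw [if_pos hb, add_comm, Nat.testBit_two_pow_add_eq, Nat.testBit_lt_two_pow hlt]
        simp [hb]
      · rw [if_neg hb, add_zero, Nat.testBit_lt_two_pow hlt]
        simp [hb]
    · have h' : ¬ j < w + 1 := by omega
      simp only [h', decide_false, Bool.false_and]
      apply Nat.testBit_lt_two_pow
      have : 2 ^ (w + 1) ≤ 2 ^ j := Nat.pow_le_pow_right (by norm_num) h
      have := pow_succ 2 w
      split_ifs <;> omega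

theorem memory_lt (w : ℕ) (D : List Bool) (k : ℕ) : memory w D k < 2 ^ w :=
  sum_bits_lt (fun j => D.getD (k * w + j) false) w

theorem testBit_memory (w : ℕ) (D : List Bool) (k j : ℕ) :
    (memory w D k).testBit j = (decide (j < w) && D.getD (k * w + j) false) :=
  testBit_sum_bits (fun j => D.getD (k * w + j) false) w j

/-- A field of at most `w` bits meets at most two consecutive words. In the aligned case `x % w = 0`
the second word is shifted left by `w` and vanishes modulo `2 ^ w`, so the code needs no branch. -/
theorem field_eq_of_bits {w x f v : ℕ} {D : List Bool} (hw : 0 < w) (hf : f ≤ w) (hv : v < 2 ^ f)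
    (hbits : ∀ j < f, D.getD (x + j) false = v.testBit j) :
    (memory w D (x / w) >>> (x % w) ||| (memory w D (x / w + 1) <<< (w - x % w)) % 2 ^ w) &&&
      (2 ^ f - 1) = v := by
  have hx := Nat.div_add_mod' x w
  have ho := Nat.mod_lt x hw
  set k := x / w
  set o := x % w
  apply Nat.eq_of_testBit_eq
  intro j
  simp only [Nat.testBit_and, Nat.testBit_or, Nat.testBit_shiftRight, Nat.testBit_mod_two_pow,
    Nat.testBit_shiftLeft, testBit_memory, Nat.testBit_two_pow_sub_one]
  by_cases hj : j < f
  · rw [← hbits j hj]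
    by_cases hjo : o + j < w
    · have h1 : ¬ w - o ≤ j := by omega
      have h2 : k * w + (o + j) = x + j := by omega
      simp [hj, hjo, h1, h2]
    · have h1 : w - o ≤ j := by omega
      have h2 : (k + 1) * w + (j - (w - o)) = x + j := by rw [add_mul]; omega
      have h3 : j - (w - o) < w := by omega
      have h4 : j < w := by omega
      simp only [hj, hjo, h1, h2, h3, h4, decide_true, decide_false, Bool.false_and, Bool.false_or,
        Bool.true_and, Bool.and_true]
  · have : v.testBit j = false :=
      Nat.testBit_lt_two_pow (hv.trans_le (Nat.pow_le_pow_right (by norm_num) (by omega)))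
    simp [hj, this]

/-- Code that puts into register `dst` the bit field at position `R[pos]`, cut down to the bits of
`R[mask]`; it expects the word length in register `2` and the number `1` in register `3`. -/
def readField (dst pos mask : ℕ) : List Instr :=
  [.op .div 20 pos 2, .op .mod 21 pos 2, .load 22 20, .op .shr 22 22 21, .op .add 20 20 3,
    .load 20 20, .op .sub 21 2 21, .op .shl 20 20 21, .op .or 22 22 20, .op .and dst 22 mask]

/-- The scratch registers are `20` to `22`; hence the frame condition on all registers below `20`
other than `dst`. -/
theorem Within.readField {w t pc : ℕ} {D : List Bool} {prog : Program} {r : ℕ → ℕ}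
    {Q : State → Prop} {dst pos mask : ℕ} (x f v : ℕ)
    (hcode : ∀ j < 10, prog[pc + j]? = (readField dst pos mask)[j]?)
    (hpos : pos < 20) (hmask : mask < 20) (hw : 0 < w) (h2 : r 2 = w) (h3 : r 3 = 1)
    (hx : r pos = x) (hm : r mask = 2 ^ f - 1) (hf : f ≤ w) (hxw : x + 1 < 2 ^ w)
    (hv : v < 2 ^ f) (hbits : ∀ j < f, D.getD (x + j) false = v.testBit j)
    (H : ∀ r' : ℕ → ℕ, r' dst = v → (∀ k < 20, k ≠ dst → r' k = r k) →
      Within w (memory w D) prog t ⟨pc + 10, r'⟩ Q) :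
    Within w (memory w D) prog (t + 10) ⟨pc, r⟩ Q := by
  have hdiv : x / w ≤ x := Nat.div_le_self x w
  have hww : w < 2 ^ w := Nat.lt_two_pow_self
  have ho := Nat.mod_lt x hw
  have e20 : pos ≠ 20 := by omega
  have e21 : pos ≠ 21 := by omega
  have e22 : pos ≠ 22 := by omega
  have m20 : mask ≠ 20 := by omega
  have m21 : mask ≠ 21 := by omega
  have m22 : mask ≠ 22 := by omega
  refine Within.op (x / w) (hcode 0 (by norm_num)) ?_ ?_
  · rw [hx, h2, eval_div (by omega)]
  refine Within.op (x % w) (hcode 1 (by norm_num)) ?_ ?_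
  · simp only [Function.update_apply, e20, if_false, hx, h2, Nat.reduceEqDiff]
    rw [eval_mod (by omega)]
  refine Within.load (memory w D (x / w)) (hcode 2 (by norm_num)) ?_ ?_
  · simp
  refine Within.op (memory w D (x / w) >>> (x % w)) (hcode 3 (by norm_num)) ?_ ?_
  · simp only [Function.update_apply, if_true, if_false, Nat.reduceEqDiff]
    rw [eval_shr (memory_lt ..)]
  refine Within.op (x / w + 1) (hcode 4 (by norm_num)) ?_ ?_
  · simp only [Function.update_apply, if_true, if_false, h3, Nat.reduceEqDiff]
    rw [eval_add (by omega)]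
  refine Within.load (memory w D (x / w + 1)) (hcode 5 (by norm_num)) ?_ ?_
  · simp
  refine Within.op (w - x % w) (hcode 6 (by norm_num)) ?_ ?_
  · simp only [Function.update_apply, if_true, if_false, h2, Nat.reduceEqDiff]
    rw [eval_sub (by omega) (by omega)]
  refine Within.op ((memory w D (x / w + 1) <<< (w - x % w)) % 2 ^ w)
    (hcode 7 (by norm_num)) ?_ ?_
  · simp only [Function.update_apply, if_true, if_false, Nat.reduceEqDiff]
    rfl
  refine Within.op (memory w D (x / w) >>> (x % w) |||
    (memory w D (x / w + 1) <<< (w - x % w)) % 2 ^ w) (hcode 8 (by norm_num)) ?_ ?_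
  · simp only [Function.update_apply, if_true, if_false, Nat.reduceEqDiff]
    exact Nat.mod_eq_of_lt (Nat.or_lt_two_pow
      ((Nat.shiftRight_le _ _).trans_lt (memory_lt ..)) (Nat.mod_lt _ (by positivity)))
  refine Within.op v (hcode 9 (by norm_num)) ?_ ?_
  · simp only [Function.update_apply, if_true, if_false, m20, m21, m22, hm]
    rw [BinOp.eval, field_eq_of_bits hw hf hv hbits]
    exact Nat.mod_eq_of_lt (hv.trans_le (Nat.pow_le_pow_right (by norm_num) hf))
  refine H _ (by simp) fun k hk hd => ?_
  have k20 : k ≠ 20 := by omega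
  have k21 : k ≠ 21 := by omega
  have k22 : k ≠ 22 := by omega
  simp [hd, k20, k21, k22]

end WordRAM

/-! ### The piece of a partition that covers a position -/

/-- For a strictly increasing sequence `st` of starting points with `st 0 = 0`, the index of the
interval `[st j, st (j + 1))` that contains `x`. -/
def cover (st : ℕ → ℕ) (x : ℕ) : ℕ := Nat.findGreatest (fun j => st j ≤ x) x

section Cover

variable {st : ℕ → ℕ} (hst : StrictMono st) (h0 : st 0 = 0) {x j : ℕ}
include hst h0

/-- The search bound `x` in `cover` loses nothing, because strict monotonicity gives `j ≤ st j`.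
This Galois connection is the source of the order facts below. -/
theorem le_cover_iff : j ≤ cover st x ↔ st j ≤ x := by
  constructor
  · intro h
    have h1 : st (cover st x) ≤ x :=
      Nat.findGreatest_spec (P := fun j => st j ≤ x) (Nat.zero_le x) (by simp [h0])
    exact (hst.monotone h).trans h1
  · intro h
    exact Nat.le_findGreatest (P := fun j => st j ≤ x) ((hst.id_le j).trans h) h

theorem cover_lt_iff : cover st x < j ↔ x < st j := by
  rw [← not_le, le_cover_iff hst h0, not_le]

theorem cover_eq_iff : cover st x = j ↔ st j ≤ x ∧ x < st (j + 1) := by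
  rw [← le_cover_iff hst h0, ← cover_lt_iff hst h0]
  omega

theorem cover_mono : Monotone (cover st) := fun x y hxy => by
  rw [le_cover_iff hst h0]
  exact ((le_cover_iff hst h0).1 le_rfl).trans hxy

omit hst h0 in
theorem cover_zero : cover st 0 = 0 := rfl

theorem cover_succ_le : cover st (x + 1) ≤ cover st x + 1 := by
  rcases Nat.eq_zero_or_pos (cover st (x + 1)) with h | h
  · omega
  · have h1 : st (cover st (x + 1)) ≤ x + 1 := (le_cover_iff hst h0).1 le_rfl
    have h2 : st (cover st (x + 1) - 1) < st (cover st (x + 1)) := hst (by omega)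
    have h3 : cover st (x + 1) - 1 ≤ cover st x := (le_cover_iff hst h0).2 (by omega)
    omega

/-- Adding the marker bit of the next position updates the interval index during a scan. -/
theorem cover_add_indicator :
    cover st x + (if cover st x < cover st (x + 1) then 1 else 0) = cover st (x + 1) := by
  have h1 := cover_succ_le hst h0 (x := x)
  have h2 := cover_mono hst h0 (Nat.le_succ x)
  simp only [Nat.succ_eq_add_one] at h2
  split_ifs <;> omega

end Cover

namespace WordRAM

/-! ### The query program -/

/-- Registers: `1` number `N` of positions, `3` one, `5` field width `s`, `6` field mask, `8` chunk
length, `10`, `13` bounds of the binary search, `11` start of the table, `12` width of a table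
entry, `17` an index of an interval, `18` a length, `19` zero. The binary search is at `15`, a hit
at `37`, the search inside a chunk at `49`, the end at `68`. -/
def queryProgram : Program :=
  [.const 3 1, .op .add 4 1 3, .load 5 5, .op .mod 5 5 4, .op .shl 6 3 5, .op .sub 6 6 3,
    .op .shr 7 1 3, .op .add 1 1 7, .const 7 8, .op .mul 8 5 7, .op .div 10 1 8, .op .add 10 10 3,
    .op .add 11 1 5, .op .add 11 11 3, .op .add 12 5 5,
    .jeq 13 10 49, .op .add 14 13 10, .op .shr 14 14 3, .op .mul 15 14 12, .op .add 15 15 11] ++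
  readField 16 15 6 ++
  [.jeq 16 0 37, .jlt 16 0 34, .op .add 10 14 19, .jmp 15, .op .add 13 14 3, .op .add 17 16 19,
    .jmp 15,
    .op .add 15 15 5] ++
  readField 18 15 6 ++
  [.jmp 68,
    .op .sub 14 13 3, .op .mul 14 14 8, .op .add 14 14 5,
    .op .add 14 14 3] ++
  readField 16 14 3 ++
  [.op .add 17 17 16, .jlt 0 17 68, .jlt 17 0 52, .op .add 18 18 3, .jmp 52,
    .op .add 0 18 19, .const 2 0]

/-- The number of positions of the partition for `n` intervals. -/
def positions (n : ℕ) : ℕ := n + n / 2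

/-- The number of chunks, of `8 * n.size` positions each. -/
def chunks (n : ℕ) : ℕ := positions n / (8 * n.size) + 1

/-- The first position of the table in the data structure. -/
def tableStart (n : ℕ) : ℕ := positions n + n.size + 1

/-- `D` consists of a header that reveals `n.size`, the characteristic bits of the starting points,
and a table with the index and the length of the interval at the start of every chunk. -/
structure Encodes (w n : ℕ) (st : ℕ → ℕ) (D : List Bool) : Prop where
  header : memory w D 0 % (n + 1) = n.size
  bits : ∀ x < positions n,
    D.getD (n.size + (x + 1)) false = decide (cover st x < cover st (x + 1))
  index : ∀ k < chunks n, ∀ j < n.size,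
    D.getD (k * (n.size + n.size) + tableStart n + j) false =
      (cover st (k * (8 * n.size))).testBit j
  length : ∀ k < chunks n, ∀ j < n.size,
    D.getD (k * (n.size + n.size) + tableStart n + n.size + j) false =
      (st (cover st (k * (8 * n.size)) + 1) - st (cover st (k * (8 * n.size)))).testBit j

/-- The contents of the registers that do not change during the search. -/
structure Env (w n i : ℕ) (r : ℕ → ℕ) : Prop where
  h0 : r 0 = i
  h1 : r 1 = positions n
  h2 : r 2 = w
  h3 : r 3 = 1
  h5 : r 5 = n.size
  h6 : r 6 = 2 ^ n.size - 1
  h8 : r 8 = 8 * n.size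
  h11 : r 11 = tableStart n
  h12 : r 12 = n.size + n.size
  h19 : r 19 = 0

theorem Env.congr {w n i d : ℕ} {r r' : ℕ → ℕ} (h : Env w n i r)
    (hr : ∀ k < 20, k ≠ d → r' k = r k) (hd : d = 10 ∨ 13 ≤ d ∧ d ≤ 18) : Env w n i r' where
  h0 := (hr 0 (by omega) (by omega)).trans h.h0
  h1 := (hr 1 (by omega) (by omega)).trans h.h1
  h2 := (hr 2 (by omega) (by omega)).trans h.h2
  h3 := (hr 3 (by omega) (by omega)).trans h.h3
  h5 := (hr 5 (by omega) (by omega)).trans h.h5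
  h6 := (hr 6 (by omega) (by omega)).trans h.h6
  h8 := (hr 8 (by omega) (by omega)).trans h.h8
  h11 := (hr 11 (by omega) (by omega)).trans h.h11
  h12 := (hr 12 (by omega) (by omega)).trans h.h12
  h19 := (hr 19 (by omega) (by omega)).trans h.h19

theorem Env.update {w n i d v : ℕ} {r : ℕ → ℕ} (h : Env w n i r)
    (hd : d = 10 ∨ 13 ≤ d ∧ d ≤ 18) : Env w n i (Function.update r d v) :=
  h.congr (fun _ _ hk => Function.update_of_ne hk _ _) hd

/-! ### Sizes of the parameters and of the addresses. -/

theorem size_pos_of_pos {n : ℕ} (hn : 0 < n) : 0 < n.size := Nat.size_pos.2 hn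

theorem size_le_self (n : ℕ) : n.size ≤ n := Nat.size_le.2 Nat.lt_two_pow_self

/-- The six spare bits of a word rule out overflow in address arithmetic. -/
theorem two_pow_large {w n : ℕ} (hw : n.size + 6 ≤ w) : 64 * (n + 1) ≤ 2 ^ w := by
  have h1 : 2 ^ (n.size + 6) ≤ 2 ^ w := Nat.pow_le_pow_right (by norm_num) hw
  have h2 := Nat.lt_size_self n
  rw [pow_add] at h1
  omega

theorem chunks_mul_le (n : ℕ) : chunks n * (8 * n.size) ≤ positions n + 8 * n.size := by
  rw [chunks, add_mul, one_mul]
  exact Nat.add_le_add_right (Nat.div_mul_le_self _ _) _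

theorem positions_lt_chunks_mul {n : ℕ} (hn : 0 < n) :
    positions n < chunks n * (8 * n.size) := by
  have := size_pos_of_pos hn
  rw [mul_comm]
  exact Nat.lt_mul_div_succ _ (by omega)

theorem positions_le (n : ℕ) : positions n ≤ 2 * n := by
  unfold positions; omega

/-- The table addresses are far below the largest word. -/
theorem entry_lt {w n k : ℕ} (hw : n.size + 6 ≤ w) (hk : k < chunks n) :
    k * (n.size + n.size) + tableStart n + n.size + 1 < 2 ^ w := by
  have h1 := two_pow_large hw
  have h2 := chunks_mul_le n
  have h3 := size_le_self n
  have h4 := positions_le n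
  have h5 : k * (8 * n.size) ≤ chunks n * (8 * n.size) := Nat.mul_le_mul_right _ hk.le
  have h6 : k * (8 * n.size) = 4 * (k * (n.size + n.size)) := by ring
  unfold tableStart
  omega

/-- The final configurations of a successful query: the answer is `len / N`. -/
def Answer (n len : ℕ) (s : State) : Prop :=
  Halted queryProgram s ∧ s.reg 0 = len ∧ s.reg 1 = positions n ∧ s.reg 2 = 0

/-! ### Correctness and step counts of the phases of a query. -/

section Query

variable {w n i : ℕ} {st : ℕ → ℕ} {D : List Bool}

theorem within_setup (hn : 0 < n) (hw : n.size + 6 ≤ w) (hD : Encodes w n st D) :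
    Within w (memory w D) queryProgram 15 (queryState w n i) (fun s => s.pc = 15 ∧
      Env w n i s.reg ∧ s.reg 10 = chunks n ∧ s.reg 13 = 0 ∧ s.reg 18 = 0) := by
  have hlarge := two_pow_large hw
  have hs := size_le_self n
  have hs0 := size_pos_of_pos hn
  have hp := positions_le n
  have hsw : 2 ^ n.size < 2 ^ w := Nat.pow_lt_pow_right (by norm_num) (by omega)
  have hdiv : positions n / (8 * n.size) ≤ positions n := Nat.div_le_self _ _
  have hpn : n + n / 2 = positions n := rfl
  refine Within.const (t := 14) rfl (by omega) ?_
  refine Within.op (n + 1) rfl ?_ ?_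
  · simp only [Function.update_apply, if_true, if_false, Nat.reduceEqDiff]
    rw [eval_add (by omega)]
  refine Within.load (memory w D 0) rfl rfl ?_
  -- The header makes the first word congruent to `n.size` modulo `n + 1`, so the field width costs
  -- one load and one `mod` instead of a loop.
  refine Within.op n.size rfl ?_ ?_
  · simp only [Function.update_apply, if_true, if_false, Nat.reduceEqDiff]
    rw [eval_mod (memory_lt ..), hD.header]
  refine Within.op (2 ^ n.size) rfl ?_ ?_
  · simp only [Function.update_apply, if_true, if_false, Nat.reduceEqDiff]
    rw [BinOp.eval, Nat.one_shiftLeft, Nat.mod_eq_of_lt hsw]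
  refine Within.op (2 ^ n.size - 1) rfl ?_ ?_
  · simp only [Function.update_apply, if_true, if_false, Nat.reduceEqDiff]
    rw [eval_sub Nat.one_le_two_pow hsw]
  refine Within.op (n / 2) rfl ?_ ?_
  · simp only [Function.update_apply, if_true, if_false, Nat.reduceEqDiff]
    rw [eval_shr (by omega), Nat.shiftRight_one]
  refine Within.op (positions n) rfl ?_ ?_
  · simp only [Function.update_apply, if_true, if_false, Nat.reduceEqDiff]
    rw [eval_add (by omega), positions]
  refine Within.const rfl (by omega) ?_
  refine Within.op (8 * n.size) rfl ?_ ?_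
  · simp only [Function.update_apply, if_true, if_false, Nat.reduceEqDiff]
    rw [eval_mul (by omega), mul_comm]
  refine Within.op (positions n / (8 * n.size)) rfl ?_ ?_
  · simp only [Function.update_apply, if_true, if_false, Nat.reduceEqDiff]
    rw [eval_div (by omega)]
  refine Within.op (chunks n) rfl ?_ ?_
  · simp only [Function.update_apply, if_true, if_false, Nat.reduceEqDiff]
    rw [eval_add (by omega), chunks]
  refine Within.op (positions n + n.size) rfl ?_ ?_
  · simp only [Function.update_apply, if_true, if_false, Nat.reduceEqDiff]
    rw [eval_add (by omega)]
  refine Within.op (tableStart n) rfl ?_ ?_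
  · simp only [Function.update_apply, if_true, if_false, Nat.reduceEqDiff]
    rw [eval_add (by omega), tableStart]
  refine Within.op (n.size + n.size) rfl ?_ ?_
  · simp only [Function.update_apply, if_true, if_false, Nat.reduceEqDiff]
    rw [eval_add (by omega)]
  exact Within.here ⟨rfl, ⟨rfl, rfl, rfl, rfl, rfl, rfl, rfl, rfl, rfl, rfl⟩, rfl, rfl, rfl⟩

/-- The configuration in which the binary search has found the table entry of a chunk that starts
inside interval `i`. -/
def Hit (w n i : ℕ) (st : ℕ → ℕ) (s : State) : Prop :=
  s.pc = 37 ∧ Env w n i s.reg ∧ ∃ m < chunks n, cover st (m * (8 * n.size)) = i ∧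
    s.reg 15 = m * (n.size + n.size) + tableStart n

/-- The configuration in which the binary search has found out that interval `i` lies strictly
inside of a chunk. -/
def Miss (w n i : ℕ) (st : ℕ → ℕ) (s : State) : Prop :=
  s.pc = 49 ∧ Env w n i s.reg ∧ s.reg 18 = 0 ∧ ∃ lo, 0 < lo ∧ lo ≤ chunks n ∧ s.reg 13 = lo ∧
    s.reg 17 = cover st ((lo - 1) * (8 * n.size)) ∧
    (∀ k < lo, cover st (k * (8 * n.size)) < i) ∧
    ∀ k, lo ≤ k → k < chunks n → i < cover st (k * (8 * n.size))

/-- The binary search takes at most `g` rounds if there are fewer than `c * 2 ^ g` candidates and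
every range of the search, unless empty, contains at least `c` of them. -/
theorem within_search (hst : StrictMono st) (h0 : st 0 = 0) (hstn : st n = positions n)
    (hn : 0 < n) (hw : n.size + 6 ≤ w) (hD : Encodes w n st D) {c : ℕ}
    (hc : ∀ lo hi, (∀ k < lo, cover st (k * (8 * n.size)) < i) →
      (∀ k, hi ≤ k → k < chunks n → i < cover st (k * (8 * n.size))) → hi ≤ chunks n → lo < hi →
      c ≤ hi - lo) (g : ℕ) :
    ∀ (lo hi : ℕ) (r : ℕ → ℕ), Env w n i r → r 13 = lo → r 10 = hi → r 18 = 0 → lo ≤ hi →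
      hi ≤ chunks n → (0 < lo → r 17 = cover st ((lo - 1) * (8 * n.size))) →
      (∀ k < lo, cover st (k * (8 * n.size)) < i) →
      (∀ k, hi ≤ k → k < chunks n → i < cover st (k * (8 * n.size))) →
      hi - lo < c * 2 ^ g →
      Within w (memory w D) queryProgram (20 * g + 1) ⟨15, r⟩
        (fun s => Hit w n i st s ∨ Miss w n i st s) := by
  have hlarge := two_pow_large hw
  have hs := size_le_self n
  have hs0 := size_pos_of_pos hn
  have hp := positions_le n
  have hns := Nat.lt_size_self n
  have hsw : 2 ^ n.size < 2 ^ w := Nat.pow_lt_pow_right (by norm_num) (by omega)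
  have hch : chunks n ≤ positions n + 1 := Nat.succ_le_succ (Nat.div_le_self _ _)
  induction g with
  | zero =>
    intro lo hi r he hlo hhi h18 hlh hhK h17 hl hh hg
    -- A nonempty range would contain at least `c` candidates, but fewer than `c * 2 ^ 0` are left.
    have heq : lo = hi := by
      by_contra hne
      have := hc lo hi hl hh hhK (by omega)
      omega
    refine Within.jeq_pos (t := 0) (l := 49) rfl (by omega) (Within.here (Or.inr ?_))
    -- Chunk `0` starts in interval `0`, so it is never discarded as lying to the right of `i`.
    have hlo0 : 0 < lo := by
      by_contra hne
      have := hh 0 (by omega) (Nat.succ_pos _)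
      rw [zero_mul, cover_zero] at this
      omega
    exact ⟨rfl, he, h18, lo, hlo0, by omega, hlo, h17 hlo0, hl, heq ▸ hh⟩
  | succ g ih =>
    intro lo hi r he hlo hhi h18 hlh hhK h17 hl hh hg
    by_cases heq : lo = hi
    · refine Within.jeq_pos (t := 20 * (g + 1)) (l := 49) rfl (by omega)
        (Within.here (Or.inr ?_))
      have hlo0 : 0 < lo := by
        by_contra hne
        have := hh 0 (by omega) (Nat.succ_pos _)
        rw [zero_mul, cover_zero] at this
        omega
      exact ⟨rfl, he, h18, lo, hlo0, by omega, hlo, h17 hlo0, hl, heq ▸ hh⟩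
    have hg' : hi - lo < c * 2 ^ g * 2 := by rw [mul_assoc, ← pow_succ]; exact hg
    obtain ⟨m, hm⟩ : ∃ m, m = (lo + hi) / 2 := ⟨_, rfl⟩
    have hmK : m < chunks n := by omega
    have haddr := entry_lt hw hmK
    have hmL : m * (8 * n.size) ≤ positions n := by
      calc m * (8 * n.size) ≤ positions n / (8 * n.size) * (8 * n.size) :=
            Nat.mul_le_mul_right _ (Nat.lt_succ_iff.1 hmK)
        _ ≤ _ := Nat.div_mul_le_self _ _
    -- A chunk may start at `N` itself, just past the partition; its index `n` still fits into the
    -- field.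
    have hcov : cover st (m * (8 * n.size)) < 2 ^ n.size := by
      have : cover st (m * (8 * n.size)) < n + 1 :=
        (cover_lt_iff hst h0).2 (hmL.trans_lt (hstn ▸ hst (Nat.lt_succ_self n)))
      omega
    have hroom : (20 * g + 1) + 20 = 20 * (g + 1) + 1 := by ring
    rw [← hroom]
    refine Within.jeq_neg rfl (by omega) ?_
    refine Within.op (lo + hi) rfl ?_ ?_
    · rw [hlo, hhi, eval_add (by omega)]
    refine Within.op m rfl ?_ ?_
    · simp only [Function.update_apply, if_true, if_false, Nat.reduceEqDiff]
      rw [he.h3, eval_shr (by omega), Nat.shiftRight_one, hm]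
    refine Within.op (m * (n.size + n.size)) rfl ?_ ?_
    · simp only [Function.update_apply, if_true, if_false, Nat.reduceEqDiff]
      rw [he.h12, eval_mul (by omega)]
    refine Within.op (m * (n.size + n.size) + tableStart n) rfl ?_ ?_
    · simp only [Function.update_apply, if_true, if_false, Nat.reduceEqDiff]
      rw [he.h11, eval_add (by omega)]
    have he1 := (((he.update (d := 14) (v := lo + hi) (by omega)).update (d := 14) (v := m)
      (by omega)).update (d := 15) (v := m * (n.size + n.size)) (by omega)).update (d := 15)
      (v := m * (n.size + n.size) + tableStart n) (by omega)
    refine Within.readField (m * (n.size + n.size) + tableStart n) n.size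
      (cover st (m * (8 * n.size))) (dst := 16) (pos := 15) (mask := 6) ?_ (by norm_num)
      (by norm_num) (by omega) he1.h2 he1.h3 (by simp) he1.h6 (by omega) (by omega) hcov
      (hD.index m hmK) ?_
    · intro j hj; interval_cases j <;> rfl
    intro r' h16 hr'
    have he2 : Env w n i r' := he1.congr hr' (by omega)
    have r10 : r' 10 = hi := by rw [hr' 10 (by omega) (by omega)]; simpa using hhi
    have r13 : r' 13 = lo := by rw [hr' 13 (by omega) (by omega)]; simpa using hlo
    have r14 : r' 14 = m := by rw [hr' 14 (by omega) (by omega)]; simp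
    have r15 : r' 15 = m * (n.size + n.size) + tableStart n := by
      rw [hr' 15 (by omega) (by omega)]; simp
    have r17 : r' 17 = r 17 := by rw [hr' 17 (by omega) (by omega)]; simp
    have r18 : r' 18 = 0 := by rw [hr' 18 (by omega) (by omega)]; simpa using h18
    have hmono := cover_mono hst h0
    rcases lt_trichotomy (cover st (m * (8 * n.size))) i with hlt | heq' | hgt
    · refine Within.jeq_neg rfl (by rw [h16, he2.h0]; omega) ?_
      refine Within.jlt_pos (l := 34) rfl (by rw [h16, he2.h0]; omega) ?_
      refine Within.op (m + 1) rfl ?_ ?_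
      · rw [r14, he2.h3, eval_add (by omega)]
      refine Within.op (cover st (m * (8 * n.size))) rfl ?_ ?_
      · simp only [Function.update_apply, if_false, Nat.reduceEqDiff]
        rw [h16, he2.h19, eval_add (by omega), add_zero]
      refine Within.jmp rfl ?_
      refine ih (m + 1) hi _ ((he2.update (by omega)).update (by omega)) (by simp) ?_ ?_
        (by omega) hhK (by simp) ?_ hh (by omega)
      · simpa using r10
      · simpa using r18
      · intro k hk
        exact (hmono (Nat.mul_le_mul_right _ (Nat.lt_succ_iff.1 hk))).trans_lt hlt
    · refine Within.jeq_pos (l := 37) rfl (by rw [h16, he2.h0, heq']) ?_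
      exact Within.here (Or.inl ⟨rfl, he2, m, hmK, heq', r15⟩)
    · refine Within.jeq_neg rfl (by rw [h16, he2.h0]; omega) ?_
      refine Within.jlt_neg rfl (by rw [h16, he2.h0]; omega) ?_
      refine Within.op m rfl ?_ ?_
      · rw [r14, he2.h19, eval_add (by omega), add_zero]
      refine Within.jmp rfl ?_
      refine (ih lo m _ (he2.update (by omega)) ?_ (by simp) ?_ (by omega) hmK.le ?_ hl ?_
        (by omega)).mono (by omega)
      · simpa using r13
      · simpa using r18
      · intro hlo0
        simpa [r17] using h17 hlo0
      · intro k hk _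
        exact hgt.trans_le (hmono (Nat.mul_le_mul_right _ hk))

/-- The other `n - 1` intervals take at least one position each. Hence lengths fit into `n.size`
bits, and `qᵢ ≤ 2/3` once `n ≥ 2`. -/
theorem length_le (hst : StrictMono st) (hstn : st n = positions n) (hi : i < n) :
    st (i + 1) - st i ≤ n / 2 + 1 := by
  have h1 : i ≤ st i := hst.id_le i
  have h2 : st (i + 1) + (n - (i + 1)) ≤ st (i + 1 + (n - (i + 1))) := by
    rw [add_comm, add_comm (i + 1)]
    exact hst.add_le_nat _ _
  rw [show i + 1 + (n - (i + 1)) = n by omega, hstn, positions] at h2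
  omega

theorem within_finish {t : ℕ} {r : ℕ → ℕ} {len : ℕ} (he : Env w n i r) (h18 : r 18 = len)
    (hlen : len < 2 ^ w) :
    Within w (memory w D) queryProgram (t + 2) ⟨68, r⟩ (Answer n len) := by
  refine Within.op len rfl ?_ ?_
  · rw [h18, he.h19, eval_add (by omega), add_zero]
  refine Within.const rfl (by positivity) (Within.here ⟨le_rfl, ?_, ?_, ?_⟩)
  · simp
  · simpa using he.h1
  · simp

theorem within_of_hit (hst : StrictMono st) (hstn : st n = positions n)
    (hi : i < n) (hw : n.size + 6 ≤ w) (hD : Encodes w n st D) {s : State}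
    (hs : Hit w n i st s) :
    Within w (memory w D) queryProgram 14 s (Answer n (st (i + 1) - st i)) := by
  obtain ⟨pc, r⟩ := s
  obtain ⟨hpc, he, m, hmK, rfl, h15⟩ := hs
  dsimp only at hpc he h15
  subst hpc
  have hlarge := two_pow_large hw
  have hns := Nat.lt_size_self n
  have hlen := length_le hst hstn hi
  have haddr := entry_lt hw hmK
  refine Within.op (t := 13) (m * (n.size + n.size) + tableStart n + n.size) rfl ?_ ?_
  · rw [h15, he.h5, eval_add (by omega)]
  have he1 := he.update (d := 15) (v := m * (n.size + n.size) + tableStart n + n.size) (by omega)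
  refine Within.readField (m * (n.size + n.size) + tableStart n + n.size) n.size _
      (dst := 18) (pos := 15) (mask := 6) ?_ (by norm_num)
      (by norm_num) (by omega) he1.h2 he1.h3 (by simp) he1.h6 (by omega) (by omega) ?_
      (hD.length m hmK) ?_
  · intro j hj; interval_cases j <;> rfl
  · omega
  intro r' h18 hr'
  exact Within.jmp rfl (within_finish (t := 0) (he1.congr hr' (by omega)) h18 (by omega))

/-- Register `18` counts the positions of interval `i` up to `x`; truncated subtraction keeps it at
`0` before the interval begins. The scan reads `d + 1` more bits, at no more than 16 steps each. -/
theorem within_scan (hst : StrictMono st) (h0 : st 0 = 0) (hstn : st n = positions n)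
    (hi : i < n) (hw : n.size + 6 ≤ w) (hD : Encodes w n st D) (d : ℕ) :
    ∀ (x : ℕ) (r : ℕ → ℕ), Env w n i r → r 14 = x + n.size → r 17 = cover st x →
      r 18 = x + 1 - st i → st (i + 1) = x + 1 + d →
      Within w (memory w D) queryProgram (16 * d + 16) ⟨52, r⟩
        (Answer n (st (i + 1) - st i)) := by
  have hlarge := two_pow_large hw
  have hs := size_le_self n
  have hp := positions_le n
  have hns := Nat.lt_size_self n
  have hsn : st (i + 1) ≤ positions n := hstn ▸ hst.monotone hi
  -- The part of the loop common to all outcomes: read one bit and advance the index, in 12 steps.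
  have key : ∀ (t x : ℕ) (r : ℕ → ℕ), Env w n i r → r 14 = x + n.size → r 17 = cover st x →
      x + 1 ≤ positions n →
      (∀ r' : ℕ → ℕ, Env w n i r' → r' 14 = x + 1 + n.size → r' 17 = cover st (x + 1) →
        r' 18 = r 18 → Within w (memory w D) queryProgram t ⟨64, r'⟩
          (Answer n (st (i + 1) - st i))) →
      Within w (memory w D) queryProgram (t + 12) ⟨52, r⟩ (Answer n (st (i + 1) - st i)) := by
    intro t x r he h14 h17 hx H
    have hcx : cover st (x + 1) ≤ x + 1 := (hst.id_le _).trans ((le_cover_iff hst h0).1 le_rfl)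
    have hind := cover_add_indicator hst h0 (x := x)
    refine Within.op (x + 1 + n.size) rfl ?_ ?_
    · rw [h14, he.h3, eval_add (by omega)]; ring
    have he1 := he.update (d := 14) (v := x + 1 + n.size) (by omega)
    -- Register `3` holds `1 = 2 ^ 1 - 1` and doubles as the mask of a one-bit field.
    refine Within.readField (x + 1 + n.size) 1 (if cover st x < cover st (x + 1) then 1 else 0)
      (dst := 16) (pos := 14) (mask := 3) ?_ (by norm_num)
      (by norm_num) (by omega) he1.h2 he1.h3 (by simp) he1.h3 (by omega) (by omega) ?_ ?_ ?_
    · intro j hj; interval_cases j <;> rfl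
    · split_ifs <;> norm_num
    · intro j hj
      obtain rfl : j = 0 := by omega
      rw [show x + 1 + n.size + 0 = n.size + (x + 1) by omega, hD.bits x (by omega)]
      split_ifs with h <;> simp [h]
    intro r' h16 hr'
    have he2 : Env w n i r' := he1.congr hr' (by omega)
    refine Within.op (cover st (x + 1)) rfl ?_ ?_
    · rw [h16, hr' 17 (by omega) (by omega), Function.update_of_ne (by norm_num), h17,
        eval_add (by omega), hind]
    refine H _ (he2.update (by omega)) ?_ (by simp) ?_
    · rw [Function.update_of_ne (by norm_num), hr' 14 (by omega) (by omega),
        Function.update_self]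
    · rw [Function.update_of_ne (by norm_num), hr' 18 (by omega) (by omega),
        Function.update_of_ne (by norm_num)]
  induction d with
  | zero =>
    intro x r he h14 h17 h18 hd
    refine key 4 x r he h14 h17 (by omega) fun r' he' h14' h17' h18' => ?_
    have hc : i + 1 ≤ cover st (x + 1) := (le_cover_iff hst h0).2 (by omega)
    refine Within.jlt_pos (l := 68) rfl (by rw [he'.h0, h17']; exact hc) ?_
    exact within_finish (t := 1) he' (by omega) (by omega)
  | succ d ih =>
    intro x r he h14 h17 h18 hd
    refine key (16 * d + 16 + 4) x r he h14 h17 (by omega) fun r' he' h14' h17' h18' => ?_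
    have hc : cover st (x + 1) < i + 1 := (cover_lt_iff hst h0).2 (by omega)
    refine Within.jlt_neg rfl (by rw [he'.h0, h17']; omega) ?_
    by_cases hlt : cover st (x + 1) < i
    · have hx := (cover_lt_iff hst h0).1 hlt
      refine Within.jlt_pos (l := 52) rfl (by rw [he'.h0, h17']; omega) ?_
      exact (ih (x + 1) r' he' h14' h17' (by omega) (by omega)).mono (by omega)
    · have hx : st i ≤ x + 1 := (le_cover_iff hst h0).1 (by omega)
      refine Within.jlt_neg rfl (by rw [he'.h0, h17']; omega) ?_
      refine Within.op (x + 1 + 1 - st i) rfl ?_ ?_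
      · rw [h18', h18, he'.h3, eval_add (by omega)]; omega
      refine Within.jmp rfl ?_
      refine ih (x + 1) _ (he'.update (by omega)) ?_ ?_ (by simp) (by omega)
      · simpa using h14'
      · simpa using h17'

/-- The interval ends within `8 * n.size` positions of the start of chunk `lo - 1`, where the scan
begins; 16 steps per position give `128 * n.size`. -/
theorem within_of_miss (hst : StrictMono st) (h0 : st 0 = 0) (hstn : st n = positions n)
    (hn : 0 < n) (hi : i < n) (hw : n.size + 6 ≤ w) (hD : Encodes w n st D) {s : State}
    (hs : Miss w n i st s) :
    Within w (memory w D) queryProgram (128 * n.size + 3) s (Answer n (st (i + 1) - st i)) := by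
  obtain ⟨pc, r⟩ := s
  obtain ⟨hpc, he, h18, lo, hlo, hloK, h13, h17, hl, hh⟩ := hs
  dsimp only at hpc he h18 h13 h17
  subst hpc
  have hlarge := two_pow_large hw
  have hs := size_le_self n
  have hp := positions_le n
  obtain ⟨l, rfl⟩ : ∃ l, lo = l + 1 := ⟨lo - 1, by omega⟩
  rw [Nat.add_sub_cancel] at h17
  have hx1 : l * (8 * n.size) < st i := (cover_lt_iff hst h0).1 (hl l (Nat.lt_succ_self l))
  have hx2 : st (i + 1) ≤ l * (8 * n.size) + 8 * n.size := by
    rw [← Nat.succ_mul]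
    -- After the last chunk no table entry bounds the interval on the right; the end of the
    -- partition does.
    rcases Nat.lt_or_ge (l + 1) (chunks n) with h | h
    · exact (le_cover_iff hst h0).1 (hh (l + 1) le_rfl h)
    · have h1 : st (i + 1) ≤ positions n := hstn ▸ hst.monotone hi
      have h2 := positions_lt_chunks_mul hn
      rw [show chunks n = l + 1 by omega] at h2
      exact (h1.trans_lt h2).le
  have hx3 : st i < st (i + 1) := hst (Nat.lt_succ_self i)
  have hsn : st (i + 1) ≤ positions n := hstn ▸ hst.monotone hi
  have hch : chunks n ≤ positions n + 1 := Nat.succ_le_succ (Nat.div_le_self _ _)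
  refine Within.op l rfl ?_ ?_
  · rw [h13, he.h3, eval_sub (by omega) (by omega), Nat.add_sub_cancel]
  refine Within.op (l * (8 * n.size)) rfl ?_ ?_
  · simp only [Function.update_apply, if_true, if_false, Nat.reduceEqDiff]
    rw [he.h8, eval_mul (by omega)]
  refine Within.op (l * (8 * n.size) + n.size) rfl ?_ ?_
  · simp only [Function.update_apply, if_true, if_false, Nat.reduceEqDiff]
    rw [he.h5, eval_add (by omega)]
  refine (within_scan hst h0 hstn hi hw hD (st (i + 1) - (l * (8 * n.size) + 1))
    (l * (8 * n.size)) _ (((he.update (by omega)).update (by omega)).update (by omega))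
    (by simp) ?_ ?_ (by omega)).mono (by omega)
  · simpa using h17
  · rw [Function.update_of_ne (by norm_num), Function.update_of_ne (by norm_num),
      Function.update_of_ne (by norm_num), h18]
    omega

/-- The unconditional bound, by a full bisection with `c = 1`; a hit only makes the query faster. -/
theorem within_query_of_miss (hst : StrictMono st) (h0 : st 0 = 0) (hstn : st n = positions n)
    (hn : 0 < n) (hi : i < n) (hw : n.size + 6 ≤ w) (hD : Encodes w n st D) :
    Within w (memory w D) queryProgram (148 * n.size + 59) (queryState w n i)
      (Answer n (st (i + 1) - st i)) := by
  have hns := Nat.lt_size_self n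
  have hp := positions_le n
  have hch : chunks n ≤ positions n + 1 := Nat.succ_le_succ (Nat.div_le_self _ _)
  have hb : 15 + (20 * (n.size + 1) + 1 + (128 * n.size + 17)) ≤ 148 * n.size + 59 := by omega
  refine Within.mono (Within.bind (within_setup hn hw hD) ?_) hb
  rintro ⟨pc, r⟩ ⟨rfl, he, h10, h13, h18⟩
  refine Within.bind (within_search hst h0 hstn hn hw hD (c := 1) (fun _ _ _ _ _ _ => by omega)
    (n.size + 1) 0 (chunks n) r he h13 h10 h18 (Nat.zero_le _) le_rfl (by omega) (by omega)
    (by omega) ?_) ?_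
  · rw [pow_succ]; omega
  · rintro s (hs | hs)
    · exact (within_of_hit hst hstn hi hw hD hs).mono (by omega)
    · exact (within_of_miss hst h0 hstn hn hi hw hD hs).mono (by omega)

/-- None of the chunks in `[a, b)` can be discarded, so `c = b - a` is admissible in
`within_search`, and a miss is impossible. -/
theorem within_query_of_hit (hst : StrictMono st) (h0 : st 0 = 0) (hstn : st n = positions n)
    (hn : 0 < n) (hi : i < n) (hw : n.size + 6 ≤ w) (hD : Encodes w n st D) {a b g : ℕ}
    (hab : a < b) (hb : b ≤ chunks n)
    (hcov : ∀ k, a ≤ k → k < b → cover st (k * (8 * n.size)) = i)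
    (hg : chunks n < (b - a) * 2 ^ g) :
    Within w (memory w D) queryProgram (20 * g + 30) (queryState w n i)
      (Answer n (st (i + 1) - st i)) := by
  have hbound : 15 + (20 * g + 1 + 14) ≤ 20 * g + 30 := by omega
  refine Within.mono (Within.bind (within_setup hn hw hD) ?_) hbound
  rintro ⟨pc, r⟩ ⟨rfl, he, h10, h13, h18⟩
  refine Within.bind (within_search hst h0 hstn hn hw hD (c := b - a) ?_
    g 0 (chunks n) r he h13 h10 h18 (Nat.zero_le _) le_rfl (by omega) (by omega)
    (by omega) (by omega)) ?_
  · intro lo hi' hl hh _ _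
    have h1 : lo ≤ a := by
      by_contra h
      have := hl a (by omega)
      have := hcov a le_rfl hab
      omega
    have h2 : b ≤ hi' := by
      by_contra h
      have := hh (b - 1) (by omega) (by omega)
      have := hcov (b - 1) (by omega) (by omega)
      omega
    omega
  · rintro s (hs | hs)
    · exact within_of_hit hst hstn hi hw hD hs
    · obtain ⟨_, _, _, lo, _, _, _, _, hl, hh⟩ := hs
      exfalso
      have h1 := hcov a le_rfl hab
      rcases Nat.lt_or_ge a lo with h | h
      · have := hl a h; omega
      · have := hh a h (by omega); omega

end Query

end WordRAM

namespace WordRAM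

/-! ### The data structure -/

/-- The bits of the data structure for the partition `st`, with header `low`. -/
def dataBit (n : ℕ) (st : ℕ → ℕ) (low y : ℕ) : Bool :=
  if y < n.size then low.testBit y
  else if y < tableStart n then decide (cover st (y - n.size - 1) < cover st (y - n.size))
  else
    let c := cover st ((y - tableStart n) / (n.size + n.size) * (8 * n.size))
    let r := (y - tableStart n) % (n.size + n.size)
    if r < n.size then c.testBit r else (st (c + 1) - st c).testBit (r - n.size)

/-- The data structure for the partition `st`, with header `low`. -/
def dataString (n : ℕ) (st : ℕ → ℕ) (low : ℕ) : List Bool :=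
  (List.range (tableStart n + chunks n * (n.size + n.size))).map (dataBit n st low)

theorem length_dataString (n : ℕ) (st : ℕ → ℕ) (low : ℕ) :
    (dataString n st low).length = tableStart n + chunks n * (n.size + n.size) := by
  simp [dataString]

theorem getD_dataString {n : ℕ} (st : ℕ → ℕ) (low : ℕ) {y : ℕ}
    (hy : y < tableStart n + chunks n * (n.size + n.size)) :
    (dataString n st low).getD y false = dataBit n st low y := by
  simp [dataString, hy]

theorem dataBit_header_irrel {n y : ℕ} (st : ℕ → ℕ) (low low' : ℕ) (hy : n.size ≤ y) :
    dataBit n st low y = dataBit n st low' y := by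
  simp [dataBit, Nat.not_lt.2 hy]

/-- The header affects only the low `n.size` bits of the first word, so it can be chosen after the
rest. -/
theorem memory_zero_dataString {w n low : ℕ} (st : ℕ → ℕ) (hw : n.size ≤ w)
    (hlow : low < 2 ^ n.size) :
    memory w (dataString n st low) 0 =
      low + 2 ^ n.size * (memory w (dataString n st 0) 0 / 2 ^ n.size) := by
  have h1 : memory w (dataString n st low) 0 % 2 ^ n.size = low := by
    apply Nat.eq_of_testBit_eq
    intro j
    rw [Nat.testBit_mod_two_pow, testBit_memory]
    by_cases hj : j < n.size
    · have hj' : j < w := by omega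
      rw [zero_mul, zero_add, getD_dataString _ _ (by unfold tableStart; omega)]
      simp [hj, hj', dataBit]
    · have : low.testBit j = false :=
        Nat.testBit_lt_two_pow (hlow.trans_le (Nat.pow_le_pow_right (by norm_num) (by omega)))
      simp [hj, this]
  have h2 : memory w (dataString n st low) 0 / 2 ^ n.size =
      memory w (dataString n st 0) 0 / 2 ^ n.size := by
    apply Nat.eq_of_testBit_eq
    intro j
    rw [Nat.testBit_div_two_pow, Nat.testBit_div_two_pow, testBit_memory, testBit_memory]
    congr 1
    rw [zero_mul, zero_add]
    by_cases hy : j + n.size < tableStart n + chunks n * (n.size + n.size)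
    · rw [getD_dataString _ _ hy, getD_dataString _ _ hy,
        dataBit_header_irrel st low 0 (by omega)]
    · rw [List.getD_eq_default, List.getD_eq_default] <;> rw [length_dataString] <;> omega
  rw [← h2]
  conv_lhs => rw [← Nat.mod_add_div (memory w (dataString n st low) 0) (2 ^ n.size), h1]

theorem exists_encodes {w n : ℕ} (st : ℕ → ℕ) (hn : 0 < n) (hw : n.size ≤ w) :
    ∃ D : List Bool, D.length = tableStart n + chunks n * (n.size + n.size) ∧
      Encodes w n st D := by
  have hs := size_le_self n
  have hs0 := size_pos_of_pos hn
  have hns := Nat.lt_size_self n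
  obtain ⟨R, hR⟩ : ∃ R, R = 2 ^ n.size * (memory w (dataString n st 0) 0 / 2 ^ n.size) := ⟨_, rfl⟩
  -- Since `n ≡ -1` modulo `n + 1`, this is `n.size - R` modulo `n + 1`; being at most `n`, it fits
  -- into the header.
  obtain ⟨low, hlow⟩ : ∃ low, low = (n.size + n * R) % (n + 1) := ⟨_, rfl⟩
  have hlt : low < n + 1 := hlow ▸ Nat.mod_lt _ (Nat.succ_pos n)
  have entry : ∀ k < chunks n, ∀ j < n.size + n.size,
      (dataString n st low).getD (k * (n.size + n.size) + tableStart n + j) false =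
        if j < n.size then (cover st (k * (8 * n.size))).testBit j
        else (st (cover st (k * (8 * n.size)) + 1) - st (cover st (k * (8 * n.size)))).testBit
          (j - n.size) := by
    intro k hk j hj
    have h1 : k * (n.size + n.size) + (n.size + n.size) ≤ chunks n * (n.size + n.size) := by
      rw [← Nat.succ_mul]
      exact Nat.mul_le_mul_right _ hk
    have h2 : k * (n.size + n.size) + tableStart n + j - tableStart n =
        (n.size + n.size) * k + j := by rw [mul_comm]; omega
    have h3 : ¬ k * (n.size + n.size) + tableStart n + j < n.size := by
      unfold tableStart; omega
    have h4 : ¬ k * (n.size + n.size) + tableStart n + j < tableStart n := by omega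
    rw [getD_dataString _ _ (by omega), dataBit, if_neg h3, if_neg h4, h2,
      Nat.mul_add_div (by omega), Nat.div_eq_of_lt hj, Nat.mul_add_mod, Nat.mod_eq_of_lt hj,
      add_zero]
  refine ⟨dataString n st low, length_dataString n st low, ⟨?_, ?_, ?_, ?_⟩⟩
  · rw [memory_zero_dataString st hw (by omega), ← hR, hlow, Nat.mod_add_mod,
      show n.size + n * R + R = n.size + (n + 1) * R by ring, Nat.add_mul_mod_self_left,
      Nat.mod_eq_of_lt (by omega)]
  · intro x hx
    have h1 : ¬ n.size + (x + 1) < n.size := by omega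
    have h2 : n.size + (x + 1) < tableStart n := by unfold tableStart; omega
    rw [getD_dataString _ _ (by omega), dataBit, if_neg h1, if_pos h2, Nat.add_sub_cancel_left,
      Nat.add_sub_cancel]
  · intro k hk j hj
    rw [entry k hk j (by omega), if_pos hj]
  · intro k hk j hj
    rw [add_assoc _ n.size j, entry k hk (n.size + j) (by omega), if_neg (by omega),
      Nat.add_sub_cancel_left]

/-- The table has at most `(N + 8 * n.size) / 4` bits, and `5N/4 ≤ 15n/8`. -/
theorem dataLength_le (n : ℕ) :
    tableStart n + chunks n * (n.size + n.size) ≤ 2 * n + (3 * n.size + 1) := by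
  have h1 := chunks_mul_le n
  have h2 : chunks n * (8 * n.size) = 4 * (chunks n * (n.size + n.size)) := by ring
  unfold tableStart positions at *
  omega

/-! ### The query time -/

theorem sq_le_four_mul_two_pow (s : ℕ) : s ^ 2 ≤ 4 * 2 ^ s := by
  induction s with
  | zero => norm_num
  | succ s ih =>
    rcases Nat.lt_or_ge s 3 with h | h
    · interval_cases s <;> norm_num
    · rw [pow_succ 2 s]
      nlinarith

theorem two_pow_size_le {n : ℕ} (hn : 0 < n) : 2 ^ n.size ≤ 2 * n := by
  have hs := size_pos_of_pos hn
  have h : 2 ^ (n.size - 1) ≤ n := Nat.lt_size.1 (by omega)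
  calc 2 ^ n.size = 2 * 2 ^ (n.size - 1) := by rw [← pow_succ', Nat.sub_add_cancel hs]
    _ ≤ 2 * n := Nat.mul_le_mul_left _ h

/-- Either the answer is found in the table within `g` rounds of the binary search, and the
interval is long in terms of `g`, or the interval is short. -/
theorem exists_within_query {w n i : ℕ} {st : ℕ → ℕ} {D : List Bool} (hst : StrictMono st)
    (h0 : st 0 = 0) (hstn : st n = positions n) (hi : i < n) (hw : n.size + 6 ≤ w)
    (hD : Encodes w n st D) :
    ∃ T : ℕ, Within w (memory w D) queryProgram T (queryState w n i)
        (Answer n (st (i + 1) - st i)) ∧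
      ((∃ g, T = 20 * g + 30 ∧ 2 ^ g * (st (i + 1) - st i) ≤ 2 ^ 6 * positions n) ∨
        T = 148 * n.size + 59 ∧
          2 ^ n.size * (st (i + 1) - st i) ^ 2 ≤ 2 ^ 10 * positions n ^ 2) := by
  have hn : 0 < n := by omega
  have hs := size_le_self n
  have hs0 := size_pos_of_pos hn
  have hpn : n ≤ positions n := Nat.le_add_right _ _
  have hlt : st i < st (i + 1) := hst (Nat.lt_succ_self i)
  have hsn : st (i + 1) ≤ positions n := hstn ▸ hst.monotone hi
  have hKL := chunks_mul_le n
  obtain ⟨L, hL⟩ : ∃ L, L = 8 * n.size := ⟨_, rfl⟩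
  have hL0 : 0 < L := by omega
  rw [← hL] at hKL
  obtain ⟨len, hlen⟩ : ∃ len, len = st (i + 1) - st i := ⟨_, rfl⟩
  rw [← hlen]
  -- the first chunks that start at or after the two ends of the interval
  obtain ⟨a, ha⟩ : ∃ a, a = (st i + (L - 1)) / L := ⟨_, rfl⟩
  obtain ⟨b, hb⟩ : ∃ b, b = (st (i + 1) + (L - 1)) / L := ⟨_, rfl⟩
  have ha1 : st i ≤ a * L := by
    have h1 := Nat.div_add_mod' (st i + (L - 1)) L
    have h2 := Nat.mod_lt (st i + (L - 1)) hL0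
    rw [← ha] at h1
    omega
  have ha2 : a * L ≤ st i + (L - 1) := ha ▸ Nat.div_mul_le_self _ _
  have hb1 : st (i + 1) ≤ b * L := by
    have h1 := Nat.div_add_mod' (st (i + 1) + (L - 1)) L
    have h2 := Nat.mod_lt (st (i + 1) + (L - 1)) hL0
    rw [← hb] at h1
    omega
  have hb2 : b * L ≤ st (i + 1) + (L - 1) := hb ▸ Nat.div_mul_le_self _ _
  have hbK : b ≤ chunks n := by
    rw [hb, chunks, ← hL]
    calc (st (i + 1) + (L - 1)) / L ≤ (positions n + L) / L := Nat.div_le_div_right (by omega)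
      _ = positions n / L + 1 := Nat.add_div_right _ hL0
  -- The chunk starts inside the interval are `a, …, b - 1`; truncated subtraction also covers the
  -- case of none.
  have hlenL : len ≤ (b - a + 1) * L := by
    have h1 : b * L ≤ (b - a + a) * L := Nat.mul_le_mul_right _ (by omega)
    rw [add_mul] at h1 ⊢
    omega
  rcases Nat.lt_or_ge a b with hab | hab
  · obtain ⟨c, hc⟩ : ∃ c, c = b - a := ⟨_, rfl⟩
    have hc0 : 0 < c := by omega
    -- `e + 1` rounds suffice, and `c * 2 ^ (e + 1)` is still at most `2 * chunks n`.
    obtain ⟨e, he⟩ : ∃ e, e = Nat.log 2 (chunks n / c) := ⟨_, rfl⟩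
    have hcK : chunks n / c ≠ 0 := (Nat.div_pos (by omega) hc0).ne'
    have he1 : 2 ^ e * c ≤ chunks n := by
      rw [← Nat.le_div_iff_mul_le hc0, he]
      exact Nat.pow_log_le_self 2 hcK
    have he2 : chunks n < c * 2 ^ (e + 1) := by
      rw [mul_comm, ← Nat.div_lt_iff_lt_mul hc0, he]
      exact Nat.lt_pow_succ_log_self (by norm_num) _
    refine ⟨20 * (e + 1) + 30, hlen ▸ within_query_of_hit hst h0 hstn hn hi hw hD hab hbK ?_
      (hc ▸ he2), Or.inl ⟨e + 1, rfl, ?_⟩⟩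
    · intro k hak hkb
      rw [← hL, cover_eq_iff hst h0]
      have h1 : a * L ≤ k * L := Nat.mul_le_mul_right _ hak
      have h2 : k * L + L ≤ b * L := by
        rw [← Nat.succ_mul]
        exact Nat.mul_le_mul_right _ hkb
      omega
    · have h1 : len ≤ 2 * (c * L) := by
        rw [← hc] at hlenL
        calc len ≤ (c + 1) * L := hlenL
          _ ≤ (2 * c) * L := Nat.mul_le_mul_right _ (by omega)
          _ = _ := by ring
      calc 2 ^ (e + 1) * len ≤ 2 ^ (e + 1) * (2 * (c * L)) := Nat.mul_le_mul_left _ h1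
        _ = 4 * (2 ^ e * c * L) := by ring
        _ ≤ 4 * (chunks n * L) := Nat.mul_le_mul_left _ (Nat.mul_le_mul_right _ he1)
        _ ≤ 2 ^ 6 * positions n := by omega
  · refine ⟨148 * n.size + 59, hlen ▸ within_query_of_miss hst h0 hstn hn hi hw hD,
      Or.inr ⟨rfl, ?_⟩⟩
    have h1 : len ≤ 8 * n.size := by
      rwa [Nat.sub_eq_zero_of_le hab, zero_add, one_mul, hL] at hlenL
    calc 2 ^ n.size * len ^ 2 ≤ 2 ^ n.size * (8 * n.size) ^ 2 :=
          Nat.mul_le_mul_left _ (Nat.pow_le_pow_left h1 2)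
      _ = 64 * (2 ^ n.size * n.size ^ 2) := by ring
      _ ≤ 64 * (2 ^ n.size * (4 * 2 ^ n.size)) := by
          gcongr; exact sq_le_four_mul_two_pow _
      _ = 256 * (2 ^ n.size) ^ 2 := by ring
      _ ≤ 256 * (2 * n) ^ 2 := by gcongr; exact two_pow_size_le hn
      _ = 2 ^ 10 * n ^ 2 := by ring
      _ ≤ 2 ^ 10 * positions n ^ 2 := by gcongr

theorem natCast_le_logb_add {a b : ℕ} {x : ℝ} (hx : 0 < x) (h : (2 : ℝ) ^ a ≤ 2 ^ b * x) :
    (a : ℝ) ≤ b + Real.logb 2 x := by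
  have h1 : Real.logb 2 (2 ^ a) ≤ Real.logb 2 (2 ^ b * x) :=
    Real.logb_le_logb_of_le (by norm_num) (by positivity) h
  rw [Real.logb_mul (by positivity) hx.ne', Real.logb_pow, Real.logb_pow] at h1
  simpa using h1

/-- With `ℓ = log₂ (1/q)`, a hit has `g ≤ 6 + ℓ` and a short interval has `n.size ≤ 10 + 2ℓ`. The
latter dominates: `148 * 10 + 59 = 1539` and `148 * 2 = 296`. -/
theorem exists_answersWithin {w n i : ℕ} {st : ℕ → ℕ} {D : List Bool} (hst : StrictMono st)
    (h0 : st 0 = 0) (hstn : st n = positions n) (hi : i < n) (hw : n.size + 6 ≤ w)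
    (hD : Encodes w n st D) {q : ℝ} (hq : q = ((st (i + 1) - st i : ℕ) : ℝ) / positions n) :
    ∃ t : ℕ, AnswersWithin queryProgram w D n i t q ∧
      (t : ℝ) ≤ 1539 + 296 * Real.logb 2 (1 / q) := by
  obtain ⟨T, ⟨t, htT, hhalt, hout0, hout1, hout2⟩, hT⟩ :=
    exists_within_query hst h0 hstn hi hw hD
  refine ⟨t, ⟨hhalt, ?_⟩, ?_⟩
  · rw [output, hout0, hout1, hout2, hq, pow_zero, mul_one]
  have hlt : st i < st (i + 1) := hst (Nat.lt_succ_self i)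
  have hsn : st (i + 1) ≤ positions n := hstn ▸ hst.monotone hi
  obtain ⟨len, hlen⟩ : ∃ len, len = st (i + 1) - st i := ⟨_, rfl⟩
  rw [← hlen] at hT hq
  have hlen0 : (0 : ℝ) < len := by
    have : 0 < len := by omega
    exact_mod_cast this
  have hN : (len : ℝ) ≤ positions n := by
    have : len ≤ positions n := by omega
    exact_mod_cast this
  have hN0 : (0 : ℝ) < positions n := hlen0.trans_le hN
  have hq' : 1 / q = positions n / len := by rw [hq, one_div_div]
  have hx : (0 : ℝ) < positions n / len := by positivity
  have hlog : 0 ≤ Real.logb 2 (positions n / len) :=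
    Real.logb_nonneg (by norm_num) ((one_le_div hlen0).2 hN)
  have htT' : (t : ℝ) ≤ T := by exact_mod_cast htT
  rw [hq']
  rcases hT with ⟨g, rfl, hg⟩ | ⟨rfl, hs⟩
  · have h1 : (2 : ℝ) ^ g * len ≤ 2 ^ 6 * positions n := by exact_mod_cast hg
    have h2 := natCast_le_logb_add (a := g) (b := 6) hx
      (by rw [← mul_div_assoc, le_div_iff₀ hlen0]; exact h1)
    push_cast at htT' h2
    linarith
  · have h1 : (2 : ℝ) ^ n.size * len ^ 2 ≤ 2 ^ 10 * positions n ^ 2 := by exact_mod_cast hs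
    have h2 := natCast_le_logb_add (a := n.size) (b := 10) (pow_pos hx 2)
      (by rw [div_pow, ← mul_div_assoc, le_div_iff₀ (by positivity)]; exact h1)
    rw [Real.logb_pow] at h2
    push_cast at htT' h2
    linarith

end WordRAM

/-! ### The distribution -/

/-- The starting points of the intervals: interval `i` has one position, plus about `n * p i / 2`
further ones. -/
noncomputable def startPoint {n : ℕ} (p : Fin n → ℝ) (j : ℕ) : ℕ :=
  j + ⌊(n / 2 : ℝ) * ∑ i with i.val < j, p i⌋₊

section StartPoint

variable {n : ℕ} {p : Fin n → ℝ}

theorem strictMono_startPoint (hp : ∀ i, 0 ≤ p i) : StrictMono (startPoint p) := by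
  refine strictMono_nat_of_lt_succ fun j => ?_
  have h : ∑ i with i.val < j, p i ≤ ∑ i with i.val < j + 1, p i :=
    Finset.sum_le_sum_of_subset_of_nonneg
      (Finset.monotone_filter_right _ fun i _ hi => Nat.lt_succ_of_lt hi) fun i _ _ => hp i
  have h' : ⌊(n / 2 : ℝ) * ∑ i with i.val < j, p i⌋₊ ≤
      ⌊(n / 2 : ℝ) * ∑ i with i.val < j + 1, p i⌋₊ :=
    Nat.floor_mono (mul_le_mul_of_nonneg_left h (by positivity))
  unfold startPoint
  omega

theorem startPoint_zero : startPoint p 0 = 0 := by simp [startPoint]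

theorem startPoint_last (hp : ∑ i, p i = 1) : startPoint p n = WordRAM.positions n := by
  have h : (Finset.univ.filter fun i : Fin n => i.val < n) = Finset.univ :=
    Finset.filter_true_of_mem fun i _ => i.isLt
  rw [startPoint, h, hp, mul_one, WordRAM.positions]
  congr 1
  exact Nat.floor_div_eq_div n 2

/-- Flooring loses less than `1` in a difference, and the guaranteed position of the interval makes
up for it. -/
theorem mul_lt_startPoint_sub (hp : ∀ i, 0 ≤ p i) (i : Fin n) :
    (n / 2 : ℝ) * p i < (startPoint p (i + 1) - startPoint p i : ℕ) := by
  have hsum : ∑ j : Fin n with j.val < i.val + 1, p j = ∑ j with j.val < i.val, p j + p i := by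
    have : (Finset.univ.filter fun j : Fin n => j.val < i.val + 1) =
        insert i (Finset.univ.filter fun j : Fin n => j.val < i.val) := by
      ext j
      simp only [Finset.mem_filter, Finset.mem_univ, true_and, Finset.mem_insert, Fin.ext_iff]
      omega
    rw [this, Finset.sum_insert (by simp), add_comm]
  have h0 : 0 ≤ (n / 2 : ℝ) * ∑ j with j.val < i.val, p j :=
    mul_nonneg (by positivity) (Finset.sum_nonneg fun j _ => hp j)
  have h1 := Nat.floor_le h0
  have h2 := Nat.lt_floor_add_one ((n / 2 : ℝ) * ∑ j with j.val < i.val + 1, p j)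
  rw [Nat.cast_sub (strictMono_startPoint hp (Nat.lt_succ_self _)).le]
  unfold startPoint
  rw [hsum] at h2 ⊢
  push_cast
  linarith

end StartPoint

/-! ### Relative entropy and the redundancy term. -/

/-- If `p i < c * q i` for all `i`, then the relative entropy is below `log₂ c`. -/
theorem relEntropy_lt_logb {n : ℕ} {p q : Fin n → ℝ} {c : ℝ} (hp : p ∈ stdSimplex ℝ (Fin n))
    (hq : ∀ i, 0 < q i) (h : ∀ i, p i / q i < c) : relEntropy p q < Real.logb 2 c := by
  have key : ∀ i, 0 < p i → p i * Real.logb 2 (p i / q i) < p i * Real.logb 2 c := fun i hi =>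
    mul_lt_mul_of_pos_left (Real.logb_lt_logb (by norm_num) (div_pos hi (hq i)) (h i)) hi
  have hex : ∃ i, 0 < p i := by
    by_contra! hne
    have := Finset.sum_nonpos fun i (_ : i ∈ Finset.univ) => hne i
    linarith [hp.2]
  have hsum : Real.logb 2 c = ∑ i, p i * Real.logb 2 c := by
    rw [← Finset.sum_mul, hp.2, one_mul]
  rw [hsum, relEntropy]
  refine Finset.sum_lt_sum (fun i _ => ?_) (hex.imp fun i hi => ⟨Finset.mem_univ i, key i hi⟩)
  rcases (hp.1 i).eq_or_lt with hi | hi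
  · simp [← hi]
  · exact (key i hi).le

/-- From `n.size ^ 2 ≤ 8 * n` one gets `n.size = O(√n)`. -/
theorem isLittleO_size : (fun n : ℕ => (n.size : ℝ)) =o[Filter.atTop] fun n : ℕ => (n : ℝ) := by
  have h1 : (fun n : ℕ => (n.size : ℝ)) =O[Filter.atTop] fun n : ℕ => Real.sqrt n := by
    refine Asymptotics.IsBigO.of_bound 3 (Filter.eventually_atTop.2 ⟨1, fun n hn => ?_⟩)
    have h2 : n.size ^ 2 ≤ 8 * n :=
      (WordRAM.sq_le_four_mul_two_pow _).trans (by have := WordRAM.two_pow_size_le hn; omega)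
    have h3 : (n.size : ℝ) ^ 2 ≤ 8 * n := by exact_mod_cast h2
    rw [Real.norm_of_nonneg (by positivity), Real.norm_of_nonneg (by positivity)]
    refine abs_le_of_sq_le_sq' ?_ (by positivity) |>.2
    rw [mul_pow, Real.sq_sqrt (by positivity)]
    linarith [(Nat.cast_nonneg n : (0 : ℝ) ≤ n)]
  refine h1.trans_isLittleO ?_
  rw [Asymptotics.isLittleO_iff_tendsto fun n hn => by simp [hn]]
  simp_rw [Real.sqrt_div_self', one_div]
  exact tendsto_inv_atTop_zero.comp (Real.tendsto_sqrt_atTop.comp tendsto_natCast_atTop_atTop)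

theorem isLittleO_redundancy :
    (fun n : ℕ => (3 * n.size + 1 : ℝ)) =o[Filter.atTop] fun n : ℕ => (n : ℝ) :=
  (isLittleO_size.const_mul_left 3).add
    (Asymptotics.isLittleO_const_left.2
      (Or.inr (tendsto_norm_atTop_atTop.comp tendsto_natCast_atTop_atTop)))

/-! ### Assembly of the theorem. -/

theorem theorem5 :
    ∃ (prog : WordRAM.Program) (κ : ℕ) (C : ℝ) (f : ℕ → ℝ),
      Asymptotics.IsLittleO Filter.atTop f (fun n : ℕ => (n : ℝ)) ∧
      ∀ (n : ℕ) (p : Fin n → ℝ), p ∈ stdSimplex ℝ (Fin n) →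
        ∃ q : Fin n → ℝ, q ∈ stdSimplex ℝ (Fin n) ∧
          (∀ i, 0 < q i ∧ p i / q i < 4) ∧
          relEntropy p q < 2 ∧
          ∀ w : ℕ, Nat.size n + κ ≤ w →
            ∃ D : List Bool, (D.length : ℝ) ≤ 2 * n + f n ∧
              ∀ i : Fin n, ∃ t : ℕ,
                WordRAM.AnswersWithin prog w D n i t (q i) ∧
                (n = 1 → (t : ℝ) ≤ C) ∧
                (2 ≤ n → (t : ℝ) ≤ C * Real.logb 2 (1 / q i)) ∧
                (0 < p i → (t : ℝ) ≤ C * (1 + Real.logb 2 (1 / p i))) := by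
  -- `3374 = 2 * 1539 + 296`: for `n ≥ 2` the additive constant is absorbed using `log₂ (1/qᵢ) ≥
  -- 1/2`.
  refine ⟨WordRAM.queryProgram, 6, 3374, fun n => 3 * n.size + 1, isLittleO_redundancy,
    fun n p hp => ?_⟩
  have hn : 0 < n := by
    rcases Nat.eq_zero_or_pos n with rfl | h
    · simpa using hp.2
    · exact h
  have hn0 : (0 : ℝ) < n := by exact_mod_cast hn
  have hst := strictMono_startPoint hp.1
  have h0 : startPoint p 0 = 0 := startPoint_zero
  have hstn := startPoint_last hp.2
  have hN : (n : ℝ) ≤ WordRAM.positions n := by exact_mod_cast Nat.le_add_right n (n / 2)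
  have hN' : (WordRAM.positions n : ℝ) ≤ 3 / 2 * n := by
    have : 2 * WordRAM.positions n ≤ 3 * n := by unfold WordRAM.positions; omega
    have : (2 * WordRAM.positions n : ℝ) ≤ 3 * n := by exact_mod_cast this
    linarith
  have hN0 : (0 : ℝ) < WordRAM.positions n := hn0.trans_le hN
  set q : Fin n → ℝ := fun i =>
    ((startPoint p (i + 1) - startPoint p i : ℕ) : ℝ) / WordRAM.positions n with hq
  have hlen : ∀ i : Fin n, (0 : ℝ) < (startPoint p (i + 1) - startPoint p i : ℕ) := fun i =>
    Nat.cast_pos.2 (Nat.sub_pos_of_lt (hst (Nat.lt_succ_self i)))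
  have hq0 : ∀ i, 0 < q i := fun i => div_pos (hlen i) hN0
  have hq1 : ∑ i, q i = 1 := by
    rw [hq, ← Finset.sum_div, div_eq_one_iff_eq hN0.ne', ← Nat.cast_sum,
      Fin.sum_univ_eq_sum_range (fun i => startPoint p (i + 1) - startPoint p i) n,
      Finset.sum_range_tsub hst.monotone, h0, hstn, Nat.sub_zero]
  have hratio : ∀ i, p i / q i < 4 := fun i => by
    have h1 := mul_lt_startPoint_sub hp.1 i
    have h2 : p i * WordRAM.positions n ≤ p i * (3 / 2 * n) :=
      mul_le_mul_of_nonneg_left hN' (hp.1 i)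
    rw [div_lt_iff₀ (hq0 i), hq, ← mul_div_assoc, lt_div_iff₀ hN0]
    nlinarith [hlen i]
  have hlog4 : Real.logb 2 4 = 2 := by
    rw [show (4 : ℝ) = 2 ^ 2 by norm_num, Real.logb_pow, Real.logb_self_eq_one (by norm_num)]
    norm_num
  refine ⟨q, ⟨fun i => (hq0 i).le, hq1⟩, fun i => ⟨hq0 i, hratio i⟩,
    hlog4 ▸ relEntropy_lt_logb hp hq0 hratio, fun w hw => ?_⟩
  obtain ⟨D, hDlen, hD⟩ := WordRAM.exists_encodes (w := w) (startPoint p) hn (by omega)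
  refine ⟨D, ?_, fun i => ?_⟩
  · have h := WordRAM.dataLength_le n
    rw [← hDlen] at h
    dsimp only
    exact_mod_cast h
  obtain ⟨t, hans, ht⟩ :=
    WordRAM.exists_answersWithin hst h0 hstn i.isLt hw hD (q := q i) rfl
  refine ⟨t, hans, ?_, ?_, ?_⟩
  · rintro rfl
    have hqi : q i = 1 := by
      rw [← hq1, Fin.sum_univ_one, Subsingleton.elim i 0]
    rw [hqi] at ht
    norm_num at ht
    exact_mod_cast ht.trans (by norm_num)
  · intro h2
    have hhalf : 1 / 2 ≤ Real.logb 2 (1 / q i) := by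
      have hle : q i ≤ 2 / 3 := by
        have h1 := WordRAM.length_le hst hstn i.isLt
        have h3 : 3 * (n / 2 + 1) ≤ 2 * WordRAM.positions n := by
          unfold WordRAM.positions; omega
        have h4 : 3 * (startPoint p (i + 1) - startPoint p i) ≤ 2 * WordRAM.positions n := by
          omega
        have h5 : (3 * (startPoint p (i + 1) - startPoint p i : ℕ) : ℝ) ≤
            2 * WordRAM.positions n := by exact_mod_cast h4
        rw [hq, div_le_iff₀ hN0]
        linarith
      have h1 : (3 / 2 : ℝ) ≤ 1 / q i := by
        rw [le_div_iff₀ (hq0 i)]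
        linarith
      -- `(3/2)² = 9/4 ≥ 2`, hence `log₂ (3/2) ≥ 1/2`.
      have h2 : (2 : ℝ) ^ 1 ≤ 2 ^ 0 * (1 / q i) ^ 2 := by nlinarith
      have h3 := WordRAM.natCast_le_logb_add (a := 1) (b := 0)
        (pow_pos (one_div_pos.2 (hq0 i)) 2) h2
      rw [Real.logb_pow] at h3
      push_cast at h3
      linarith
    linarith
  · intro hpi
    have hpi1 : p i ≤ 1 := hp.2 ▸ Finset.single_le_sum (fun j _ => hp.1 j) (Finset.mem_univ i)
    have hlog : 0 ≤ Real.logb 2 (1 / p i) :=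
      Real.logb_nonneg (by norm_num) ((one_le_div hpi).2 hpi1)
    have h1 := Real.logb_le_logb_of_le (b := 2) (by norm_num) (div_pos hpi (hq0 i)) (hratio i).le
    rw [hlog4, Real.logb_div hpi.ne' (hq0 i).ne'] at h1
    rw [one_div, Real.logb_inv] at ht hlog ⊢
    linarith
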